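/- Let $n\in\mathbb N$ and $0<\theta\le q<\infty$. For $k\in\mathbb Z$ and $m\in\mathbb Z^n$ let $Q_{k,m}=2^{-k}([0,1)^n+m)$ and $\chi_{k,m}=\chi_{Q_{k,m}}$; let $\mathcal Q$ be the set of all these dyadic cubes, $l(P)$ the side length of a cube $P$, and $|\cdot|$ Lebesgue measure. A weight is a nonnegative locally integrable function on $\mathbb R^n$ with values in $(0,\infty)$ almost everywhere. Let $\{t_k\}_{k\in\mathbb Z}$ be a $q$-admissible weight sequence, i.e. each $t_k$ is a weight belonging to $L_q^{\mathrm{loc}}(\mathbb R^n)$. Put $\sigma_1=\theta\,(q/\theta)'$, where $'$ denotes the conjugate exponent (so $\sigma_1=\infty$ if $\theta=q$), and suppose that for some $C_1>0$ $$M_{Q,q}(t_k)\,M_{Q,\sigma_1}(t_k^{-1})\le C_1$$ for every $k\in\mathbb Z$ and every cube $Q\subset\mathbb R^n$ with sides parallel to the coordinate axes, where $M_{Q,p}(f)=\big(\frac1{|Q|}\int_Q|f|^p\,dx\big)^{1/p}$ for $0<p<\infty$ and $M_{Q,\infty}(f)=\operatorname{ess\,sup}_{Q}|f|$. Let $\varepsilon>0$,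 and suppose that for each dyadic cube $Q_{k,m}$ there is a measurable set $E_{Q_{k,m}}\subseteq Q_{k,m}$ with $|E_{Q_{k,m}}|>\varepsilon|Q_{k,m}|$. For $\lambda=\{\lambda_{k,m}\}_{k\in\mathbb Z,m\in\mathbb Z^n}\subset\mathbb C$ put $$\big\|\lambda|\dot f_{\infty,q}(\mathbb R^n,\{t_k\})\big\|=\sup_{P\in\mathcal Q}\Big(\frac1{|P|}\int_P\sum_{k=-\log_2 l(P)}^\infty\sum_{m\in\mathbb Z^n}2^{\frac{knq}2}t_k^q(x)|\lambda_{k,m}|^q\chi_{k,m}(x)\,dx\Big)^{1/q}\in[0,\infty].$$ Then $$\big\|\lambda|\dot f_{\infty,q}(\mathbb R^n,\{t_k\})\big\|\approx\sup_{P\in\mathcal Q}\Big(\frac1{|P|}\int_P\sum_{k=-\log_2 l(P)}^\infty\sum_{m\in\mathbb Z^n}2^{\frac{knq}2}t_k^q(x)|\lambda_{k,m}|^q\chi_{E_{Q_{k,m}}}(x)\,dx\Big)^{1/q}$$ for all such $\lambda$, i.e. each side is at most $c$ times the other, with a constant $c\in(0,\infty)$ that depends only on $n,q,\theta,\varepsilon$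 and $C_1$ (in particular, not on $\lambda$; both sides may be $\infty$). -/

import Mathlib

open MeasureTheory
open scoped ENNReal NNReal

noncomputable section

namespace CarlesonSeq

/-- The half-open cube in `ℝⁿ` with sides parallel to the axes, lower corner `a`
and side length `l`. -/
def cube {n : ℕ} (a : Fin n → ℝ) (l : ℝ) : Set (Fin n → ℝ) :=
  {x | ∀ i, a i ≤ x i ∧ x i < a i + l}

/-- The dyadic cube `Q_{k,m} = 2^{-k}([0,1)ⁿ + m)`. -/
def dyadicCube {n : ℕ} (k : ℤ) (m : Fin n → ℤ) : Set (Fin n → ℝ) :=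
  cube (fun i => (2 : ℝ) ^ (-k) * (m i : ℝ)) ((2 : ℝ) ^ (-k))

/-- A weight: a nonnegative locally integrable function which takes values in `(0, ∞)`
almost everywhere. The exceptional values `0` and `∞` are allowed on a null set. -/
structure IsWeight {n : ℕ} (w : (Fin n → ℝ) → ℝ≥0∞) : Prop where
  locallyIntegrable : LocallyIntegrable w volume
  pos_finite : ∀ᵐ x ∂(volume : Measure (Fin n → ℝ)), 0 < w x ∧ w x < ∞

/-- A `p`-admissible weight sequence: a sequence of weights, each in `L_p^loc`. -/
structure IsAdmissible {n : ℕ} (p : ℝ≥0∞) (t : ℤ → (Fin n → ℝ) → ℝ≥0∞) : Prop where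
  isWeight : ∀ k, IsWeight (t k)
  memLp_loc : ∀ k, ∀ K : Set (Fin n → ℝ), IsCompact K → MemLp (t k) p (volume.restrict K)

/-- The `p`-mean `M_{A,p}(f) = (|A|⁻¹ ∫_A |f|^p)^{1/p}`, and the essential supremum of `|f|`
over `A` when `p = ∞`: the `L_p` norm for the normalised Lebesgue measure on `A`. -/
def mean {n : ℕ} (A : Set (Fin n → ℝ)) (p : ℝ≥0∞) (f : (Fin n → ℝ) → ℝ≥0∞) : ℝ≥0∞ :=
  eLpNorm f p ((volume A)⁻¹ • volume.restrict A)

/-- The diagonal case `j = k` of the condition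
`M_{Q,p}(t_k) M_{Q,σ}(t_j⁻¹) ≤ C 2^{α (k - j)}` for all cubes `Q`. -/
def DiagonalBound {n : ℕ} (p σ : ℝ≥0∞) (C : ℝ≥0) (t : ℤ → (Fin n → ℝ) → ℝ≥0∞) : Prop :=
  ∀ (k : ℤ) (a : Fin n → ℝ) (l : ℝ), 0 < l →
    mean (cube a l) p (t k) * mean (cube a l) σ (fun x => (t k x)⁻¹) ≤ (C : ℝ≥0∞)

/-- The Carleson-type supremum over dyadic cubes `P = Q_{j,h}` (so `j = -log₂ l(P)`) of
`(|P|⁻¹ ∫_P ∑_{k ≥ j} ∑_m 2^{knq/2} t_k(x)^q |λ_{k,m}|^q χ_{E_{k,m}}(x) dx)^{1/q}`. -/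
def carlesonSup {n : ℕ} (q : ℝ) (t : ℤ → (Fin n → ℝ) → ℝ≥0∞)
    (E : ℤ → (Fin n → ℤ) → Set (Fin n → ℝ)) (lam : ℤ → (Fin n → ℤ) → ℂ) : ℝ≥0∞ :=
  ⨆ (j : ℤ) (h : Fin n → ℤ),
    ((volume (dyadicCube j h))⁻¹ *
      ∫⁻ x in dyadicCube j h,
        ∑' (k : Set.Ici j) (m : Fin n → ℤ),
          (E k m).indicator
            (fun y => (2 : ℝ≥0∞) ^ (((k : ℤ) : ℝ) * n * q / 2) * t k y ^ q * ‖lam k m‖ₑ ^ q) x)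
      ^ (1 / q)

/-- The quasi-norm of the sequence space `ḟ_{∞,q}(ℝⁿ, {t_k})`; it is `∞` exactly when the
sequence does not belong to the space. -/
def fInftyNorm {n : ℕ} (q : ℝ) (t : ℤ → (Fin n → ℝ) → ℝ≥0∞)
    (lam : ℤ → (Fin n → ℤ) → ℂ) : ℝ≥0∞ :=
  carlesonSup q t dyadicCube lam

end CarlesonSeq

end

open MeasureTheory
open scoped ENNReal NNReal

namespace CarlesonSeq

/-! Fix a cube `Q` with normalised Lebesgue measure `μ`, and let `σ = θ (q/θ)'`, so that `1/θ = 1/q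
+ 1/σ`. Hölder for `1 = t * t⁻¹` on `E ⊆ Q` gives `μ(E)^(1/θ) ≤ ‖t‖_{L_q(E)} ‖t⁻¹‖_{L_σ(Q)}`.
Multiplying by `‖t‖_{L_q(Q)}` and using the bound `C₁` on the product of means yields `ε^(1/θ)
‖t‖_{L_q(Q)} ≤ C₁ ‖t‖_{L_q(E)}` (`measure_rpow_mul_lintegral_le`). By Tonelli the Carleson integral
over `P` is a sum over single cubes, each contained in `P` or disjoint from it, so this estimate
applies term by term (`lintegral_dyadic_le`) and no maximal inequality is needed. -/

/-- Hölder's inequality applied to `1 = f * f⁻¹` on `E`. -/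
theorem measure_rpow_le_of_holder {α : Type*} [MeasurableSpace α] {μ : Measure α}
    {θ q : ℝ} (hθ : 0 < θ) (hθq : θ ≤ q) {f : α → ℝ≥0∞} (hf : AEMeasurable f μ)
    (hpos : ∀ᵐ x ∂μ, 0 < f x ∧ f x < ∞) (E : Set α) :
    μ E ^ (1 / θ) ≤ (∫⁻ x in E, f x ^ q ∂μ) ^ (1 / q) *
      eLpNorm (fun x => (f x)⁻¹)
        (ENNReal.ofReal θ * ENNReal.conjExponent (ENNReal.ofReal (q / θ))) μ := by
  have hq : 0 < q := hθ.trans_le hθq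
  have hposE : ∀ᵐ x ∂μ.restrict E, 0 < f x ∧ f x < ∞ := ae_restrict_of_ae hpos
  rcases hθq.eq_or_lt with rfl | hlt
  -- Endpoint `θ = q`: `conjExponent 1 = 1 + 0⁻¹ = ∞` in `ℝ≥0∞`.
  · have hσ : ENNReal.ofReal θ * ENNReal.conjExponent (ENNReal.ofReal (θ / θ)) = ∞ := by
      rw [div_self hθ.ne', ENNReal.ofReal_one, ENNReal.conjExponent]
      simp [hθ]
    rw [hσ, eLpNorm_exponent_top]
    set A := eLpNormEssSup (fun x => (f x)⁻¹) μ with hA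
    have hle : ∀ᵐ x ∂μ.restrict E, (f x)⁻¹ ≤ A :=
      ae_restrict_of_ae (ae_le_eLpNormEssSup (f := fun x => (f x)⁻¹) (μ := μ))
    have key : μ E ≤ (∫⁻ x in E, f x ^ θ ∂μ) * A ^ θ := by
      rw [← lintegral_mul_const'' _ (hf.restrict.pow_const θ), ← setLIntegral_one]
      refine lintegral_mono_ae ?_
      filter_upwards [hle, hposE] with x hx hx'
      rw [← ENNReal.mul_rpow_of_nonneg _ _ hθ.le]
      refine ENNReal.one_le_rpow ?_ hθ
      rw [← ENNReal.mul_inv_cancel hx'.1.ne' hx'.2.ne]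
      gcongr
    calc μ E ^ (1 / θ) ≤ ((∫⁻ x in E, f x ^ θ ∂μ) * A ^ θ) ^ (1 / θ) := by gcongr
      _ = _ := by
        rw [ENNReal.mul_rpow_of_nonneg _ _ (by positivity), one_div,
          ENNReal.rpow_rpow_inv hθ.ne']
  · have h1 : 0 < q / θ - 1 := sub_pos.2 ((one_lt_div hθ).2 hlt)
    -- The finite value of `σ`, equal to `θ q / (q - θ)`.
    set s : ℝ := θ * (1 + (q / θ - 1)⁻¹) with hs
    have hs0 : 0 < s := by positivity
    have hσ : ENNReal.ofReal θ * ENNReal.conjExponent (ENNReal.ofReal (q / θ))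
        = ENNReal.ofReal s := by
      rw [ENNReal.conjExponent, hs, ENNReal.ofReal_mul hθ.le,
        ENNReal.ofReal_add zero_le_one (by positivity), ENNReal.ofReal_inv_of_pos h1,
        ENNReal.ofReal_sub _ zero_le_one, ENNReal.ofReal_one]
    have hqθ : q - θ ≠ 0 := (sub_pos.2 hlt).ne'
    have hrel : 1 / θ = 1 / q + 1 / s := by
      have : s = θ * q / (q - θ) := by
        rw [hs]; field_simp; ring
      rw [this]; field_simp; ring
    have hone : μ E = ∫⁻ x in E, (f * fun x => (f x)⁻¹) x ^ θ ∂μ := by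
      rw [← setLIntegral_one]
      refine lintegral_congr_ae ?_
      filter_upwards [hposE] with x hx
      rw [Pi.mul_apply, ENNReal.mul_inv_cancel hx.1.ne' hx.2.ne, ENNReal.one_rpow]
    have hH := ENNReal.lintegral_Lp_mul_le_Lq_mul_Lr hθ hlt hrel (μ.restrict E)
      hf.restrict hf.restrict.inv
    rw [hσ, eLpNorm_eq_lintegral_rpow_enorm_toReal (ENNReal.ofReal_pos.2 hs0).ne'
      ENNReal.ofReal_ne_top, ENNReal.toReal_ofReal hs0.le, hone]
    refine hH.trans ?_
    gcongr
    · exact Measure.restrict_le_self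
    · exact le_rfl

/-- A weight with bounded product of means has, on a subset, an `L_q` norm comparable to the
whole one. -/
theorem measure_rpow_mul_lintegral_le {α : Type*} [MeasurableSpace α] {μ : Measure α}
    {θ q : ℝ} (hθ : 0 < θ) (hθq : θ ≤ q) {f : α → ℝ≥0∞} (hf : AEMeasurable f μ)
    (hpos : ∀ᵐ x ∂μ, 0 < f x ∧ f x < ∞) {C : ℝ≥0∞}
    (hC : eLpNorm f (ENNReal.ofReal q) μ * eLpNorm (fun x => (f x)⁻¹)
      (ENNReal.ofReal θ * ENNReal.conjExponent (ENNReal.ofReal (q / θ))) μ ≤ C) (E : Set α) :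
    μ E ^ (1 / θ) * (∫⁻ x, f x ^ q ∂μ) ^ (1 / q) ≤
      C * (∫⁻ x in E, f x ^ q ∂μ) ^ (1 / q) := by
  have hq : 0 < q := hθ.trans_le hθq
  rw [eLpNorm_eq_lintegral_rpow_enorm_toReal (ENNReal.ofReal_pos.2 hq).ne'
      ENNReal.ofReal_ne_top, ENNReal.toReal_ofReal hq.le] at hC
  simp only [enorm_eq_self] at hC
  refine (mul_le_mul_left (measure_rpow_le_of_holder hθ hθq hf hpos E) _).trans ?_
  rw [mul_assoc, mul_comm, mul_comm (eLpNorm _ _ _)]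
  gcongr

theorem volume_cube {n : ℕ} (a : Fin n → ℝ) (l : ℝ) :
    volume (cube a l) = ENNReal.ofReal l ^ n := by
  have : cube a l = Set.pi Set.univ fun i => Set.Ico (a i) (a i + l) := by
    ext x; simp [cube]
  rw [this, Real.volume_pi_Ico]
  simp

theorem measurableSet_cube {n : ℕ} (a : Fin n → ℝ) (l : ℝ) : MeasurableSet (cube a l) := by
  have : cube a l = Set.pi Set.univ fun i => Set.Ico (a i) (a i + l) := by
    ext x; simp [cube]
  rw [this]
  exact MeasurableSet.univ_pi fun i => measurableSet_Ico

/-- A dyadic cube is contained in a larger one or disjoint from it. -/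
theorem dyadicCube_subset_or_disjoint {n : ℕ} {j k : ℤ} (hjk : j ≤ k) (h m : Fin n → ℤ) :
    dyadicCube k m ⊆ dyadicCube j h ∨ Disjoint (dyadicCube k m) (dyadicCube j h) := by
  rw [or_iff_not_imp_right, Set.not_disjoint_iff]
  rintro ⟨x, hxk, hxj⟩ y hy i
  obtain ⟨N, hN⟩ : ∃ N : ℕ, k = j + N := ⟨(k - j).toNat, by omega⟩
  have hscale : (2 : ℝ) ^ (-j) = 2 ^ (-k) * 2 ^ N := by
    rw [← zpow_natCast, ← zpow_add₀ two_ne_zero]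
    congr 1; omega
  have hr : (0 : ℝ) < 2 ^ (-k) := by positivity
  have hk := hxk i
  have hj := hxj i
  have hyk := hy i
  dsimp only at hk hj hyk ⊢
  rw [hscale] at hj ⊢
  generalize (2 : ℝ) ^ (-k) = r at *
  -- A common point only gives strict inequalities; integrality sharpens them to `2^N h ≤ m` and `m
  -- + 1 ≤ 2^N (h + 1)`, which is the inclusion.
  have e1 : (2 ^ N * h i : ℤ) < m i + 1 := by
    have : r * (2 ^ N * h i) < r * (m i + 1) := by linarith
    exact_mod_cast lt_of_mul_lt_mul_left this hr.le
  have e2 : m i < (2 ^ N * (h i + 1) : ℤ) := by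
    have : r * m i < r * (2 ^ N * (h i + 1)) := by linarith
    exact_mod_cast lt_of_mul_lt_mul_left this hr.le
  have e1' : (2 ^ N * h i : ℝ) ≤ m i := by exact_mod_cast Int.lt_add_one_iff.1 e1
  have e2' : (m i + 1 : ℝ) ≤ 2 ^ N * (h i + 1) := by exact_mod_cast e2
  have f1 := mul_le_mul_of_nonneg_left e1' hr.le
  have f2 := mul_le_mul_of_nonneg_left e2' hr.le
  constructor <;> linarith

/-- The restriction `k ≥ j` matters: no cube in the sum is larger than `P`, so none is cut by `P`,
and a bound on whole cubes suffices. -/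
theorem lintegral_dyadic_le {n : ℕ} {q : ℝ} {t : ℤ → (Fin n → ℝ) → ℝ≥0∞}
    (ht : ∀ k, AEMeasurable (t k) volume) {E F : ℤ → (Fin n → ℤ) → Set (Fin n → ℝ)}
    (hE : ∀ k m, NullMeasurableSet (E k m) volume)
    (hF : ∀ k m, NullMeasurableSet (F k m) volume)
    (hEsub : ∀ k m, E k m ⊆ dyadicCube k m) (hFsub : ∀ k m, F k m ⊆ dyadicCube k m)
    {C : ℝ≥0∞}
    (hEF : ∀ k m, ∫⁻ x in E k m, t k x ^ q ≤ C * ∫⁻ x in F k m, t k x ^ q)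
    (lam : ℤ → (Fin n → ℤ) → ℂ) (j : ℤ) (h : Fin n → ℤ) :
    (∫⁻ x in dyadicCube j h, ∑' (k : Set.Ici j) (m : Fin n → ℤ),
      (E k m).indicator
        (fun y => (2 : ℝ≥0∞) ^ (((k : ℤ) : ℝ) * n * q / 2) * t k y ^ q * ‖lam k m‖ₑ ^ q) x) ≤
    C * ∫⁻ x in dyadicCube j h, ∑' (k : Set.Ici j) (m : Fin n → ℤ),
      (F k m).indicator
        (fun y => (2 : ℝ≥0∞) ^ (((k : ℤ) : ℝ) * n * q / 2) * t k y ^ q * ‖lam k m‖ₑ ^ q) x := by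
  have hmeas : ∀ (k : ℤ) (m : Fin n → ℤ), AEMeasurable
      (fun y => (2 : ℝ≥0∞) ^ ((k : ℝ) * n * q / 2) * t k y ^ q * ‖lam k m‖ₑ ^ q) volume :=
    fun k m => (((ht k).pow_const q).const_mul _).mul_const _
  have hsum : ∀ G : ℤ → (Fin n → ℤ) → Set (Fin n → ℝ),
      (∀ k m, NullMeasurableSet (G k m) volume) →
      (∫⁻ x in dyadicCube j h, ∑' (k : Set.Ici j) (m : Fin n → ℤ),
        (G k m).indicator
          (fun y => (2 : ℝ≥0∞) ^ (((k : ℤ) : ℝ) * n * q / 2) * t k y ^ q * ‖lam k m‖ₑ ^ q) x) =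
      ∑' (k : Set.Ici j) (m : Fin n → ℤ), (2 : ℝ≥0∞) ^ (((k : ℤ) : ℝ) * n * q / 2) *
        ‖lam k m‖ₑ ^ q * ∫⁻ x in G k m ∩ dyadicCube j h, t k x ^ q := by
    intro G hG
    have hGm : ∀ (k : ℤ) (m : Fin n → ℤ), AEMeasurable ((G k m).indicator
        (fun y => (2 : ℝ≥0∞) ^ ((k : ℝ) * n * q / 2) * t k y ^ q * ‖lam k m‖ₑ ^ q))
        (volume.restrict (dyadicCube j h)) :=
      fun k m => ((hmeas k m).indicator₀ (hG k m)).restrict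
    rw [lintegral_tsum fun k : Set.Ici j => AEMeasurable.tsum fun m => hGm k m]
    refine tsum_congr fun k => ?_
    rw [lintegral_tsum fun m => hGm k m]
    refine tsum_congr fun m => ?_
    rw [setLIntegral_indicator₀ _ ((hG k m).mono_ac Measure.restrict_le_self.absolutelyContinuous),
      ← lintegral_const_mul'' _ ((ht k).pow_const q).restrict]
    refine lintegral_congr fun x => ?_
    ring
  rw [hsum E hE, hsum F hF, ← ENNReal.tsum_mul_left]
  refine ENNReal.tsum_le_tsum fun k => ?_
  rw [← ENNReal.tsum_mul_left]
  refine ENNReal.tsum_le_tsum fun m => ?_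
  rw [mul_left_comm]
  gcongr
  rcases dyadicCube_subset_or_disjoint k.2 h m with hs | hd
  · rw [Set.inter_eq_left.2 ((hEsub k m).trans hs), Set.inter_eq_left.2 ((hFsub k m).trans hs)]
    exact hEF k m
  · rw [(hd.mono_left (hEsub k m)).inter_eq]
    simp

theorem carlesonSup_le_mul {n : ℕ} {q : ℝ} (hq : 0 < q) {t : ℤ → (Fin n → ℝ) → ℝ≥0∞}
    (ht : ∀ k, AEMeasurable (t k) volume) {E F : ℤ → (Fin n → ℤ) → Set (Fin n → ℝ)}
    (hE : ∀ k m, NullMeasurableSet (E k m) volume)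
    (hF : ∀ k m, NullMeasurableSet (F k m) volume)
    (hEsub : ∀ k m, E k m ⊆ dyadicCube k m) (hFsub : ∀ k m, F k m ⊆ dyadicCube k m)
    {c : ℝ≥0∞}
    (hEF : ∀ k m, (∫⁻ x in E k m, t k x ^ q) ^ (1 / q) ≤
      c * (∫⁻ x in F k m, t k x ^ q) ^ (1 / q))
    (lam : ℤ → (Fin n → ℤ) → ℂ) :
    carlesonSup q t E lam ≤ c * carlesonSup q t F lam := by
  -- Summing over cubes requires the estimate without the root; the factor `c ^ q` becomes `c` again
  -- under the outer power `1 / q`.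
  have hEF' : ∀ k m, ∫⁻ x in E k m, t k x ^ q ≤ c ^ q * ∫⁻ x in F k m, t k x ^ q := by
    intro k m
    have := ENNReal.rpow_le_rpow (hEF k m) hq.le
    rwa [ENNReal.mul_rpow_of_nonneg _ _ hq.le, one_div, ENNReal.rpow_inv_rpow hq.ne',
      ENNReal.rpow_inv_rpow hq.ne'] at this
  refine iSup₂_le fun j h => ?_
  refine le_trans ?_ (mul_le_mul_right (le_iSup₂ (α := ℝ≥0∞) j h) c)
  calc _ ≤ (c ^ q * _) ^ (1 / q) := by
        refine ENNReal.rpow_le_rpow ?_ (by positivity)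
        rw [mul_left_comm]
        gcongr
        exact lintegral_dyadic_le ht hE hF hEsub hFsub hEF' lam j h
    _ = _ := by
        rw [ENNReal.mul_rpow_of_nonneg _ _ (by positivity : 0 ≤ 1 / q), one_div,
          ENNReal.rpow_rpow_inv hq.ne']

theorem DiagonalBound.lintegral_dyadicCube_le {n : ℕ} {θ q : ℝ} (hθ : 0 < θ) (hθq : θ ≤ q)
    {C₁ : ℝ≥0} {ε : ℝ} (hε : 0 < ε) {t : ℤ → (Fin n → ℝ) → ℝ≥0∞}
    (ht : ∀ k, IsWeight (t k))
    (hD : DiagonalBound (ENNReal.ofReal q)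
      (ENNReal.ofReal θ * ENNReal.conjExponent (ENNReal.ofReal (q / θ))) C₁ t)
    {k : ℤ} {m : Fin n → ℤ} {E : Set (Fin n → ℝ)} (hEsub : E ⊆ dyadicCube k m)
    (hEε : ENNReal.ofReal ε * volume (dyadicCube k m) < volume E) :
    (∫⁻ x in dyadicCube k m, t k x ^ q) ^ (1 / q) ≤
      (ENNReal.ofReal ε ^ (1 / θ))⁻¹ * C₁ * (∫⁻ x in E, t k x ^ q) ^ (1 / q) := by
  have hq : 0 < q := hθ.trans_le hθq
  have hl : (0 : ℝ) < 2 ^ (-k) := by positivity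
  have hvol : volume (dyadicCube k m) = ENNReal.ofReal (2 ^ (-k)) ^ n := volume_cube _ _
  have hQ0 : volume (dyadicCube k m) ≠ 0 := by
    rw [hvol]; exact pow_ne_zero _ (ENNReal.ofReal_pos.2 hl).ne'
  have hQt : volume (dyadicCube k m) ≠ ∞ := by
    rw [hvol]; exact ENNReal.pow_ne_top ENNReal.ofReal_ne_top
  have hQm : MeasurableSet (dyadicCube k m) := measurableSet_cube _ _
  set v := (volume (dyadicCube k m))⁻¹ with hv
  have hv0 : v ≠ 0 := ENNReal.inv_ne_zero.2 hQt
  have hvt : v ≠ ∞ := ENNReal.inv_ne_top.2 hQ0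
  set μ : Measure (Fin n → ℝ) := v • volume.restrict (dyadicCube k m) with hμ
  have hf : AEMeasurable (t k) μ :=
    ((ht k).locallyIntegrable.aestronglyMeasurable.aemeasurable.restrict).smul_measure _
  have hpos : ∀ᵐ x ∂μ, 0 < t k x ∧ t k x < ∞ :=
    Measure.ae_smul_measure (ae_restrict_of_ae (ht k).pos_finite) _
  have key := measure_rpow_mul_lintegral_le hθ hθq hf hpos (hD k _ _ hl) E
  have hμE : ENNReal.ofReal ε ≤ μ E := by
    rw [hμ, Measure.smul_apply, Measure.restrict_apply' hQm, Set.inter_eq_left.2 hEsub,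
      smul_eq_mul, hv, mul_comm, ← div_eq_mul_inv]
    exact (ENNReal.le_div_iff_mul_le (Or.inl hQ0) (Or.inl hQt)).2 hEε.le
  have hμr : μ.restrict E = v • volume.restrict E := by
    rw [hμ, Measure.restrict_smul, Measure.restrict_restrict_of_subset hEsub]
  have hvq0 : v ^ (1 / q) ≠ 0 := (ENNReal.rpow_pos hv0.bot_lt hvt).ne'
  have hvqt : v ^ (1 / q) ≠ ∞ := ENNReal.rpow_ne_top_of_nonneg (by positivity) hvt
  -- Both integrals carry the same factor `|Q|^(-1/q)`, which is neither `0` nor `∞` and cancels.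
  rw [hμr, hμ, lintegral_smul_measure, lintegral_smul_measure, smul_eq_mul, smul_eq_mul, ← hμ,
    ENNReal.mul_rpow_of_nonneg _ _ (by positivity : 0 ≤ 1 / q),
    ENNReal.mul_rpow_of_nonneg _ _ (by positivity : 0 ≤ 1 / q), mul_left_comm,
    mul_left_comm (C₁ : ℝ≥0∞), ENNReal.mul_le_mul_iff_right hvq0 hvqt] at key
  have hε0 : ENNReal.ofReal ε ^ (1 / θ) ≠ 0 :=
    (ENNReal.rpow_pos (ENNReal.ofReal_pos.2 hε) ENNReal.ofReal_ne_top).ne'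
  have hεt : ENNReal.ofReal ε ^ (1 / θ) ≠ ∞ :=
    ENNReal.rpow_ne_top_of_nonneg (by positivity) ENNReal.ofReal_ne_top
  rw [mul_assoc, mul_comm, ← div_eq_mul_inv,
    ENNReal.le_div_iff_mul_le (Or.inl hε0) (Or.inl hεt), mul_comm]
  refine le_trans ?_ key
  gcongr

end CarlesonSeq

theorem mainTheorem9 (n : ℕ) (θ q : ℝ) (hθ : 0 < θ) (hθq : θ ≤ q)
    (C₁ : ℝ≥0) (hC₁ : 0 < C₁) (ε : ℝ) (hε : 0 < ε) :
    ∃ c : ℝ≥0, 0 < c ∧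
      ∀ t : ℤ → (Fin n → ℝ) → ℝ≥0∞,
        CarlesonSeq.IsAdmissible (ENNReal.ofReal q) t →
        CarlesonSeq.DiagonalBound (ENNReal.ofReal q)
          (ENNReal.ofReal θ * ENNReal.conjExponent (ENNReal.ofReal (q / θ))) C₁ t →
      ∀ E : ℤ → (Fin n → ℤ) → Set (Fin n → ℝ),
        (∀ k m, NullMeasurableSet (E k m) volume) →
        (∀ k m, E k m ⊆ CarlesonSeq.dyadicCube k m) →
        (∀ k m, ENNReal.ofReal ε * volume (CarlesonSeq.dyadicCube k m) < volume (E k m)) →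
      ∀ lam : ℤ → (Fin n → ℤ) → ℂ,
        CarlesonSeq.fInftyNorm q t lam ≤ (c : ℝ≥0∞) * CarlesonSeq.carlesonSup q t E lam ∧
        CarlesonSeq.carlesonSup q t E lam ≤ (c : ℝ≥0∞) * CarlesonSeq.fInftyNorm q t lam := by

  have hq : 0 < q := hθ.trans_le hθq
  set a : ℝ≥0∞ := (ENNReal.ofReal ε ^ (1 / θ))⁻¹ * C₁ with ha
  have hat : a ≠ ∞ := ENNReal.mul_ne_top (ENNReal.inv_ne_top.2
    (ENNReal.rpow_pos (ENNReal.ofReal_pos.2 hε) ENNReal.ofReal_ne_top).ne') ENNReal.coe_ne_top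
  -- The constant `a` serves the hard direction, `1` the direction that follows from `E ⊆ Q`.
  refine ⟨max 1 a.toNNReal, by positivity, fun t ht hD E hEm hEsub hEε lam => ?_⟩
  have hmeas : ∀ k, AEMeasurable (t k) volume := fun k =>
    (ht.isWeight k).locallyIntegrable.aestronglyMeasurable.aemeasurable
  have hQm : ∀ (k : ℤ) (m : Fin n → ℤ),
      NullMeasurableSet (CarlesonSeq.dyadicCube k m) volume := fun k m =>
    (CarlesonSeq.measurableSet_cube _ _).nullMeasurableSet
  have hac : a ≤ ((max 1 a.toNNReal : ℝ≥0) : ℝ≥0∞) := by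
    rw [← ENNReal.coe_toNNReal hat]
    exact ENNReal.coe_le_coe.2 (le_max_right _ _)
  have h1c : (1 : ℝ≥0∞) ≤ ((max 1 a.toNNReal : ℝ≥0) : ℝ≥0∞) := by
    exact_mod_cast le_max_left 1 a.toNNReal
  constructor
  · refine (CarlesonSeq.carlesonSup_le_mul hq hmeas hQm hEm (fun _ _ => subset_rfl) hEsub
      (fun k m => ?_) lam).trans (mul_le_mul_left hac _)
    exact hD.lintegral_dyadicCube_le hθ hθq hε ht.isWeight (hEsub k m) (hEε k m)
  · refine (CarlesonSeq.carlesonSup_le_mul (c := 1) hq hmeas hEm hQm hEsub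
      (fun _ _ => subset_rfl) (fun k m => ?_) lam).trans (mul_le_mul_left h1c _)
    rw [one_mul]
    exact ENNReal.rpow_le_rpow (lintegral_mono_set (hEsub k m)) (by positivity)
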